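/- Let $X$ be a metrizable topological space. Let $CL(X)$ be the set of all nonempty closed subsets of $X$, equipped with the Vietoris topology $\tau_V$, i.e. the topology generated by the sets $$\langle U_1,\dots,U_k\rangle=\Big\{H\in CL(X): H\subseteq \bigcup_{i=1}^k U_i \text{ and } H\cap U_j\neq\emptyset \text{ for } 1\le j\le k\Big\},$$ where $k\in\mathbb N$ and $U_1,\dots,U_k$ are open subsets of $X$. Let $\omega^\omega$ be the set of all functions $\omega\to\omega$, ordered by $\alpha\le\beta$ iff $\alpha(n)\le\beta(n)$ for all $n\in\omega$. A topological space $Y$ is said to have an $\omega^\omega$-base if every point $y\in Y$ has a neighborhood base $\{U_\alpha[y]:\alpha\in\omega^\omega\}$ (whose members are not required to be open) such that $U_\beta[y]\subseteq U_\alpha[y]$ whenever $\alpha\le\beta$ in $\omega^\omega$. Then $(CL(X),\tau_V)$ has an $\omega^\omega$-base if and only if $X$ is separable and the boundary of every closed subset of $X$ is $\sigma$-compact (a union of countably many compact sets). -/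

import Mathlib

open Set Topology TopologicalSpace

/-- A topological space `Y` has an `ω^ω`-base if every point `y` has a neighbourhood base
`{U α : α ∈ ω^ω}` with `U β ⊆ U α` whenever `α ≤ β`; the order on `ℕ → ℕ` is the pointwise one. -/
def HasOmegaOmegaBase (Y : Type*) [TopologicalSpace Y] : Prop :=
  ∀ y : Y, ∃ U : (ℕ → ℕ) → Set Y, (𝓝 y).HasBasis (fun _ => True) U ∧ Antitone U

/-- `CL X`: the nonempty closed subsets of `X`. -/
def CL (X : Type*) [TopologicalSpace X] : Type _ :=
  {A : Set X // A.Nonempty ∧ IsClosed A}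

/-- The Vietoris topology on `CL X`: the subspace topology from Mathlib's Vietoris topology on
`Set X`. -/
instance CL.instTopologicalSpace (X : Type*) [TopologicalSpace X] : TopologicalSpace (CL X) :=
  TopologicalSpace.induced (fun A : CL X => A.1) (TopologicalSpace.vietoris X)

/-- `⟨U₁, …, U_k⟩ = {H ∈ CL X : H ⊆ ⋃ᵢ Uᵢ and H ∩ Uⱼ ≠ ∅ for every j}`. -/
def CL.basic {X : Type*} [TopologicalSpace X] (𝒰 : Set (Set X)) : Set (CL X) :=
  {H | H.1 ⊆ ⋃₀ 𝒰 ∧ ∀ U ∈ 𝒰, (H.1 ∩ U).Nonempty}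

/-- The topology on `CL X` is the one generated by the sets `⟨U₁, …, U_k⟩` with all `Uᵢ` open;
these sets even form a base. -/
theorem CL.isTopologicalBasis (X : Type*) [TopologicalSpace X] :
    IsTopologicalBasis
      {S : Set (CL X) | ∃ 𝒰 : Set (Set X), 𝒰.Finite ∧ (∀ U ∈ 𝒰, IsOpen U) ∧ S = CL.basic 𝒰} := by
  let _ := TopologicalSpace.vietoris X
  have h := IsTopologicalBasis.induced (fun A : CL X => A.1)
    (TopologicalSpace.vietoris.isTopologicalBasis (α := X))
  have e : {S : Set (CL X) | ∃ 𝒰 : Set (Set X),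
      𝒰.Finite ∧ (∀ U ∈ 𝒰, IsOpen U) ∧ S = CL.basic 𝒰} =
      (preimage fun A : CL X => A.1) ''
        ((fun u : Set (Set X) => {s | s ⊆ ⋃₀ u ∧ ∀ U ∈ u, (s ∩ U).Nonempty}) ''
          {u : Set (Set X) | u.Finite ∧ ∀ U ∈ u, IsOpen U}) := by
    ext S
    constructor
    · rintro ⟨𝒰, hf, ho, rfl⟩
      exact ⟨_, ⟨𝒰, ⟨hf, ho⟩, rfl⟩, rfl⟩
    · rintro ⟨_, ⟨𝒰, ⟨hf, ho⟩, rfl⟩, rfl⟩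
      exact ⟨𝒰, hf, ho, rfl⟩
  exact e ▸ h

/-! Necessity. If a maximal `ε`-separated set `D` were uncountable, infinitely many of its balls
would be controlled by one index `β`; but `U β` contains a finite subset of `D`, which meets only
finitely many of them. So `X` is separable. For the frontier, embed `X` in the Hilbert cube by `e`
and attach to each finite sequence `s` the open set `G s = dominatedSet A V e s`. A point of `G s`
off `e '' A` survives into some `G (s ++ [i])`, while a frontier point must drop out at some `s`.
Hence `e '' frontier A` is a countable union of sets `G s \ ⋃ i, G (s ++ [i])` cut with a closed
set, and these are `Fσ` in a compact metrizable space. Sufficiency. If `frontier H = ⋃ n, K n` with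
`K n` compact, `α (n + 1)` sets the radius of a thickening of `K n`, and `α 0` counts the basic open
sets to be hit. -/

/-! ### Bounded subfamilies of `ℕ → ℕ` -/

/-- At coordinate `k` only the finitely many `b n` with `n ≤ k` can differ from `x`. -/
theorem exists_forall_le_of_forall_lt_eq (b : ℕ → ℕ → ℕ) (x : ℕ → ℕ)
    (h : ∀ n, ∀ i < n, b n i = x i) : ∃ β : ℕ → ℕ, ∀ n, b n ≤ β := by
  refine ⟨fun k => x k + ∑ n ∈ Finset.range (k + 1), b n k, fun n k => ?_⟩
  by_cases hk : k < n
  · simp [h n k hk]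
  · have : b n k ≤ ∑ n ∈ Finset.range (k + 1), b n k :=
      Finset.single_le_sum (f := fun n => b n k) (fun _ _ => Nat.zero_le _)
        (Finset.mem_range.2 (by omega))
    exact this.trans (Nat.le_add_left _ _)

/-- An uncountable family in `ℕ → ℕ` has an infinite subfamily with a pointwise upper bound. -/
theorem exists_infinite_setOf_le {ι : Type*} {D : Set ι} (hD : ¬ D.Countable)
    (a : ι → ℕ → ℕ) : ∃ β : ℕ → ℕ, {d ∈ D | a d ≤ β}.Infinite := by
  -- A condensation point `x`: otherwise countably many cylinders, each with countably many indices,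
  -- would cover `D`.
  obtain ⟨x, hx⟩ : ∃ x : ℕ → ℕ, ∀ n, ¬ {d ∈ D | ∀ i < n, a d i = x i}.Countable := by
    by_contra! H
    apply hD
    have : (⋃ p ∈ {p : Σ n, Fin n → ℕ | {d ∈ D | ∀ i : Fin p.1, a d i = p.2 i}.Countable},
        {d ∈ D | ∀ i : Fin p.1, a d i = p.2 i}).Countable :=
      (Set.to_countable _).biUnion fun p hp => hp
    refine this.mono fun d hd => ?_
    obtain ⟨n, hn⟩ := H (a d)
    refine mem_biUnion (x := (⟨n, fun i => a d i⟩ : Σ n, Fin n → ℕ)) ?_ (And.intro hd fun i => rfl)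
    refine hn.mono fun e (he : e ∈ D ∧ ∀ i : Fin n, a e i = a d i) =>
      And.intro he.1 fun i hi => he.2 ⟨i, hi⟩
  obtain ⟨f, hf, hr⟩ := exists_seq_of_forall_finset_exists
    (fun p : ℕ × ι => p.2 ∈ {d ∈ D | ∀ i < p.1, a d i = x i})
    (fun p q => p.1 < q.1 ∧ p.2 ≠ q.2) (by
      classical
      intro s _
      obtain ⟨d, hd, hs⟩ := (show {d ∈ D | ∀ i < s.sup Prod.fst + 1, a d i = x i}.Infinite from
        fun h => hx _ h.countable).exists_notMem_finset (s.image Prod.snd)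
      refine ⟨(s.sup Prod.fst + 1, d), hd, fun p hp => ⟨?_, ?_⟩⟩
      · exact Nat.lt_succ_of_le (Finset.le_sup (f := Prod.fst) hp)
      · rintro rfl
        exact hs (Finset.mem_image_of_mem _ hp))
  have hmono : StrictMono fun n => (f n).1 := fun m n h => (hr m n h).1
  obtain ⟨β, hβ⟩ := exists_forall_le_of_forall_lt_eq (fun n => a (f n).2) x
    fun n i hi => (hf n).2 i (hi.trans_le (hmono.le_apply))
  have hinj : Function.Injective fun n => (f n).2 := by
    intro m n h
    rcases lt_trichotomy m n with hl | hl | hl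
    · exact absurd h (hr m n hl).2
    · exact hl
    · exact absurd h.symm (hr n m hl).2
  refine ⟨β, (infinite_range_of_injective hinj).mono ?_⟩
  rintro _ ⟨n, rfl⟩
  exact ⟨(hf n).1, hβ n⟩

/-! ### Vietoris neighbourhoods and separability -/

namespace CL

variable {X : Type*} [TopologicalSpace X]

theorem mem_nhds_iff {H : CL X} {N : Set (CL X)} :
    N ∈ 𝓝 H ↔ ∃ 𝒰 : Set (Set X), 𝒰.Finite ∧ (∀ U ∈ 𝒰, IsOpen U) ∧
      H ∈ basic 𝒰 ∧ basic 𝒰 ⊆ N := by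
  rw [(CL.isTopologicalBasis X).mem_nhds_iff]
  constructor
  · rintro ⟨_, ⟨𝒰, hf, ho, rfl⟩, hH, hN⟩
    exact ⟨𝒰, hf, ho, hH, hN⟩
  · rintro ⟨𝒰, hf, ho, hH, hN⟩
    exact ⟨_, ⟨𝒰, hf, ho, rfl⟩, hH, hN⟩

theorem setOf_subset_mem_nhds {H : CL X} {W : Set X} (hW : IsOpen W) (h : H.1 ⊆ W) :
    {F : CL X | F.1 ⊆ W} ∈ 𝓝 H := by
  refine mem_nhds_iff.2 ⟨{W}, finite_singleton W, by simpa, ⟨by simpa, ?_⟩, ?_⟩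
  · rintro _ rfl
    exact H.2.1.mono (subset_inter Subset.rfl h)
  · intro F hF
    simpa using hF.1

theorem setOf_inter_nonempty_mem_nhds {H : CL X} {W : Set X} (hW : IsOpen W)
    (h : (H.1 ∩ W).Nonempty) : {F : CL X | (F.1 ∩ W).Nonempty} ∈ 𝓝 H := by
  refine mem_nhds_iff.2 ⟨{W, univ}, by simp, by simp [hW], ⟨by simp, ?_⟩, ?_⟩
  · rintro _ (rfl | rfl)
    · exact h
    · simpa using H.2.1
  · intro F hF
    exact hF.2 W (by simp)

end CL

/-- An `ω^ω`-base at a closed set in the Vietoris topology yields one for its neighbourhood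
filter in the space. -/
theorem HasOmegaOmegaBase.exists_hasBasis_nhdsSet {X : Type*} [TopologicalSpace X] [T1Space X]
    (h : HasOmegaOmegaBase (CL X)) {A : Set X} (hne : A.Nonempty) (hA : IsClosed A) :
    ∃ V : (ℕ → ℕ) → Set X, (𝓝ˢ A).HasBasis (fun _ => True) V ∧ Antitone V := by
  obtain ⟨U, hU, hanti⟩ := h ⟨A, hne, hA⟩
  refine ⟨fun α => ⋃ F ∈ U α, F.1, ⟨fun t => ?_⟩, fun α β hαβ =>
    biUnion_subset_biUnion_left (hanti hαβ)⟩
  constructor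
  · intro ht
    obtain ⟨W, hW, hAW, hWt⟩ := mem_nhdsSet_iff_exists.1 ht
    obtain ⟨α, -, hα⟩ := hU.mem_iff.1 (CL.setOf_subset_mem_nhds (H := ⟨A, hne, hA⟩) hW hAW)
    exact ⟨α, trivial, iUnion₂_subset fun F hF => (hα hF).trans hWt⟩
  · rintro ⟨α, -, hα⟩
    obtain ⟨𝒰, -, ho, hH, hN⟩ := CL.mem_nhds_iff.1 (hU.mem_of_mem (i := α) trivial)
    refine mem_nhdsSet_iff_exists.2 ⟨⋃₀ 𝒰, isOpen_sUnion ho, hH.1, fun x hx => hα ?_⟩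
    -- Adding one point of `⋃₀ 𝒰` to `A` stays in `basic 𝒰`, so the union of the members of `U α`
    -- covers `⋃₀ 𝒰`.
    refine mem_biUnion (x := (⟨insert x A, insert_nonempty _ _, ?_⟩ : CL X)) (hN ⟨?_, ?_⟩)
      (mem_insert _ _)
    · rw [insert_eq]
      exact isClosed_singleton.union hA
    · exact insert_subset hx hH.1
    · exact fun W hW => (hH.2 W hW).mono (inter_subset_inter_left _ (subset_insert _ _))

theorem HasOmegaOmegaBase.separableSpace {X : Type*} [TopologicalSpace X] [MetrizableSpace X]
    (h : HasOmegaOmegaBase (CL X)) : SeparableSpace X := by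
  let _ := metrizableSpaceMetric X
  suffices SecondCountableTopology X by infer_instance
  refine Metric.secondCountable_of_almost_dense_set fun ε hε => ?_
  obtain ⟨D, hD⟩ : ∃ D : Set X, Maximal (fun s : Set X => s.Pairwise fun x y => ε ≤ dist x y) D := by
    refine zorn_subset _ fun c hc hchain => ⟨⋃₀ c, ?_, fun s hs => subset_sUnion_of_mem hs⟩
    exact (pairwise_sUnion hchain.directedOn).2 hc
  refine ⟨D, ?_, fun x => ?_⟩
  swap
  · by_contra! hx
    have hins : (insert x D).Pairwise fun x y => ε ≤ dist x y :=
      hD.prop.insert fun y hy _ => ⟨(hx y hy).le, (dist_comm x y) ▸ (hx y hy).le⟩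
    have hxD : x ∈ D := hD.le_of_ge hins (subset_insert _ _) (mem_insert _ _)
    exact absurd (hx x hxD) (by simpa using hε.le)
  by_contra hunc
  have hDne : D.Nonempty := by
    by_contra h0
    exact hunc (by simp [not_nonempty_iff_eq_empty.1 h0])
  obtain ⟨U, hU, hanti⟩ := h ⟨D, hDne, Metric.isClosed_of_pairwise_le_dist hε hD.prop⟩
  have hN : ∀ d, ∃ α, d ∈ D → U α ⊆ {F | (F.1 ∩ Metric.ball d ε).Nonempty} := by
    intro d
    by_cases hd : d ∈ D
    · obtain ⟨α, -, hα⟩ := hU.mem_iff.1 (CL.setOf_inter_nonempty_mem_nhds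
        (H := ⟨D, hDne, Metric.isClosed_of_pairwise_le_dist hε hD.prop⟩)
        Metric.isOpen_ball ⟨d, hd, Metric.mem_ball_self hε⟩)
      exact ⟨α, fun _ => hα⟩
    · exact ⟨0, fun h => absurd h hd⟩
  choose a ha using hN
  obtain ⟨β, hβ⟩ := exists_infinite_setOf_le hunc a
  obtain ⟨𝒰, hfin, ho, hH, hsub⟩ := CL.mem_nhds_iff.1 (hU.mem_of_mem (i := β) trivial)
  obtain ⟨d₀, hd₀⟩ := hDne
  have hp : ∀ W, ∃ x, W ∈ 𝒰 → x ∈ D ∩ W := by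
    intro W
    by_cases hW : W ∈ 𝒰
    · obtain ⟨x, hx⟩ := hH.2 W hW
      exact ⟨x, fun _ => hx⟩
    · exact ⟨d₀, fun h => absurd h hW⟩
  choose p hp using hp
  have hFfin : (insert d₀ (p '' 𝒰)).Finite := (hfin.image p).insert d₀
  have hFD : insert d₀ (p '' 𝒰) ⊆ D := by
    refine insert_subset hd₀ ?_
    rintro _ ⟨W, hW, rfl⟩
    exact (hp W hW).1
  have hF : (⟨_, insert_nonempty _ _, hFfin.isClosed⟩ : CL X) ∈ U β :=
    hsub ⟨hFD.trans hH.1, fun W hW =>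
      ⟨p W, mem_insert_of_mem _ (mem_image_of_mem p hW), (hp W hW).2⟩⟩
  refine hβ (hFfin.subset fun d hd => ?_)
  obtain ⟨y, hyF, hyd⟩ := ha d hd.1 (hanti hd.2 hF)
  by_cases hyd' : y = d
  · exact hyd' ▸ hyF
  · exact absurd (hD.prop (hFD hyF) hd.1 hyd') (not_le.2 hyd)

/-! ### Sigma-compactness of frontiers -/

/-- `β : ℕ → ℕ` has the finite sequence `s` as an initial segment. -/
def HasInitialSegment (s : List ℕ) (β : ℕ → ℕ) : Prop :=
  ∃ n, (List.range n).map β = s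

theorem hasInitialSegment_nil (β : ℕ → ℕ) : HasInitialSegment [] β := ⟨0, rfl⟩

theorem HasInitialSegment.exists_append {s : List ℕ} {β : ℕ → ℕ} (h : HasInitialSegment s β) :
    ∃ i, HasInitialSegment (s ++ [i]) β := by
  obtain ⟨n, rfl⟩ := h
  exact ⟨β n, n + 1, by simp [List.range_succ]⟩

theorem HasInitialSegment.eq_of_lt {α β : ℕ → ℕ} {n : ℕ}
    (h : HasInitialSegment ((List.range n).map α) β) {i : ℕ} (hi : i < n) : β i = α i := by
  obtain ⟨m, hm⟩ := h
  obtain rfl : m = n := by simpa using congrArg List.length hm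
  exact List.map_inj_left.1 hm i (List.mem_range.2 hi)

section Domination

variable {X Z : Type*} [TopologicalSpace X] [TopologicalSpace Z]

/-- Every subset of `e ⁻¹' W` that is separated from `A` by a neighbourhood of `A` misses some
`V β` with `β` extending `s`. -/
def IsDominated (A : Set X) (V : (ℕ → ℕ) → Set X) (e : X → Z) (s : List ℕ) (W : Set Z) : Prop :=
  ∀ C : Set X, C ⊆ e ⁻¹' W → Cᶜ ∈ 𝓝ˢ A → ∃ β, HasInitialSegment s β ∧ Disjoint C (V β)

/-- The union of all open sets dominated along `s`. -/
def dominatedSet (A : Set X) (V : (ℕ → ℕ) → Set X) (e : X → Z) (s : List ℕ) : Set Z :=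
  ⋃₀ {W | IsOpen W ∧ IsDominated A V e s W}

variable {A : Set X} {V : (ℕ → ℕ) → Set X} {e : X → Z}

theorem isOpen_dominatedSet (s : List ℕ) : IsOpen (dominatedSet A V e s) :=
  isOpen_sUnion fun _ hW => hW.1

theorem dominatedSet_nil (hV : (𝓝ˢ A).HasBasis (fun _ => True) V) :
    dominatedSet A V e [] = univ := by
  refine eq_univ_of_univ_subset (subset_sUnion_of_mem ⟨isOpen_univ, fun C _ hC => ?_⟩)
  obtain ⟨β, -, hβ⟩ := hV.mem_iff.1 hC
  exact ⟨β, hasInitialSegment_nil β, (subset_compl_iff_disjoint_left.1 hβ)⟩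

/-- Otherwise neighbourhoods shrinking to `z` carry a bad set `C i` for each `i`. These accumulate
only over `z ∉ e '' A`, so their union is still separated from `A`; the `β` given for it extends
some `s ++ [i]`, contradicting the choice of `C i`. -/
theorem exists_mem_dominatedSet_append [T2Space Z] [FirstCountableTopology Z]
    (he : Continuous e) {s : List ℕ} {z : Z} (hz : z ∈ dominatedSet A V e s) (hzA : z ∉ e '' A) :
    ∃ i, z ∈ dominatedSet A V e (s ++ [i]) := by
  obtain ⟨W, ⟨hWo, hW⟩, hzW⟩ := hz
  by_contra! H
  obtain ⟨B, hB⟩ := (𝓝 z).exists_antitone_basis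
  have hC : ∀ i, ∃ C : Set X, C ⊆ e ⁻¹' (W ∩ interior (B i)) ∧ Cᶜ ∈ 𝓝ˢ A ∧
      ∀ β, HasInitialSegment (s ++ [i]) β → ¬ Disjoint C (V β) := by
    intro i
    by_contra! hcon
    refine H i ⟨W ∩ interior (B i), ⟨hWo.inter isOpen_interior, fun C h₁ h₂ => hcon C h₁ h₂⟩,
      hzW, mem_interior_iff_mem_nhds.2 (hB.mem i)⟩
  choose C hCsub hCA hCV using hC
  have hfree : (⋃ i, C i)ᶜ ∈ 𝓝ˢ A := by
    refine mem_nhdsSet_iff_forall.2 fun x hx => ?_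
    have hne : z ≠ e x := fun h => hzA ⟨x, hx, h.symm⟩
    obtain ⟨P, hP, Q, hQ, hPQ⟩ := (disjoint_nhds_nhds.2 hne |> Filter.disjoint_iff.1)
    obtain ⟨n, hn⟩ := hB.mem_iff.1 hP
    have h₁ : (⋂ i ∈ Finset.range n, (C i)ᶜ) ∈ 𝓝 x :=
      (Filter.biInter_finset_mem _).2 fun i _ => mem_nhdsSet_iff_forall.1 (hCA i) x hx
    filter_upwards [h₁, he.continuousAt.preimage_mem_nhds hQ] with y hy hyQ hyC
    obtain ⟨i, hi⟩ := mem_iUnion.1 hyC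
    by_cases hin : i < n
    · exact mem_iInter₂.1 hy i (Finset.mem_range.2 hin) hi
    · exact hPQ.le_bot ⟨hn (hB.antitone (not_lt.1 hin) (interior_subset (hCsub i hi).2)), hyQ⟩
  obtain ⟨β, hβs, hβ⟩ := hW _ (iUnion_subset fun i x hx => (hCsub i hx).1) hfree
  obtain ⟨i, hi⟩ := hβs.exists_append
  exact hCV i β hi (hβ.mono_left (subset_iUnion C i))

/-- Otherwise an infinite branch `α` keeps `e x` in every dominated set. Points `y n ∉ A` tending to
`x` then avoid `V (b n)` with `b n` agreeing with `α` below `n`; a common bound `β` makes all `y n`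
avoid `V β`, a neighbourhood of `x`. -/
theorem exists_mem_dominatedSet_forall_notMem_append [FirstCountableTopology X]
    [T1Space X] (he : Continuous e) (hA : IsClosed A) (hV : (𝓝ˢ A).HasBasis (fun _ => True) V)
    (hanti : Antitone V) {x : X} (hx : x ∈ frontier A) :
    ∃ s, e x ∈ dominatedSet A V e s ∧ ∀ i, e x ∉ dominatedSet A V e (s ++ [i]) := by
  by_contra! H
  choose i hi using H
  let L : ℕ → {s // e x ∈ dominatedSet A V e s} := fun n =>
    Nat.rec ⟨[], by simp [dominatedSet_nil hV]⟩ (fun _ s => ⟨s.1 ++ [i s.1 s.2], hi s.1 s.2⟩) n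
  let α : ℕ → ℕ := fun n => i (L n).1 (L n).2
  have hL : ∀ n, (List.range n).map α = (L n).1 := by
    intro n
    induction n with
    | zero => rfl
    | succ n ih => rw [List.range_succ, List.map_append, ih]; rfl
  obtain ⟨B, hB⟩ := (𝓝 x).exists_antitone_basis
  have hxA : x ∈ A := hA.frontier_subset hx
  have hy : ∀ n, ∃ y, y ∈ B n ∧ ∃ β, HasInitialSegment ((List.range n).map α) β ∧ y ∉ V β := by
    intro n
    obtain ⟨W, ⟨hWo, hW⟩, hxW⟩ := (hL n).symm ▸ (L n).2
    have hcl : x ∈ closure Aᶜ := (frontier_eq_closure_inter_closure (s := A) ▸ hx).2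
    obtain ⟨y, ⟨hyW, hyB⟩, hyA⟩ := mem_closure_iff_nhds.1 hcl _
      (Filter.inter_mem (he.continuousAt.preimage_mem_nhds (hWo.mem_nhds hxW))
        (hB.mem n))
    have hfree : ({y} : Set X)ᶜ ∈ 𝓝ˢ A :=
      isClosed_singleton.isOpen_compl.mem_nhdsSet.2 fun a ha hay => hyA (hay ▸ ha)
    obtain ⟨β, hβs, hβ⟩ := hW {y} (singleton_subset_iff.2 hyW) hfree
    exact ⟨y, hyB, β, hβs, disjoint_singleton_left.1 hβ⟩
  choose y hyB b hbs hyb using hy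
  obtain ⟨β, hβ⟩ := exists_forall_le_of_forall_lt_eq b α fun n j hj => (hbs n).eq_of_lt hj
  have hmem : V β ∈ 𝓝 x := mem_nhdsSet_iff_forall.1 (hV.mem_of_mem (i := β) trivial) x hxA
  obtain ⟨n, hn⟩ := hB.mem_iff.1 hmem
  exact hyb n (hanti (hβ n) (hn (hyB n)))

end Domination

theorem isSigmaCompact_frontier_of_hasBasis_nhdsSet {X : Type*} [TopologicalSpace X]
    [MetrizableSpace X] [SeparableSpace X] {A : Set X} (hA : IsClosed A)
    {V : (ℕ → ℕ) → Set X} (hV : (𝓝ˢ A).HasBasis (fun _ => True) V) (hanti : Antitone V) :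
    IsSigmaCompact (frontier A) := by
  let _ := metrizableSpaceMetric X
  obtain ⟨e, he⟩ := Metric.PiNatEmbed.exists_embedding_to_hilbert_cube (X := X)
  let _ := metrizableSpaceMetric (ℕ → unitInterval)
  rw [he.isSigmaCompact_iff]
  have key : e '' frontier A = ⋃ s : List ℕ, dominatedSet A V e s ∩
      ((⋃ i, dominatedSet A V e (s ++ [i]))ᶜ ∩ closure (e '' frontier A)) := by
    ext z
    constructor
    · rintro ⟨x, hx, rfl⟩
      obtain ⟨s, hs, hs'⟩ :=
        exists_mem_dominatedSet_forall_notMem_append he.continuous hA hV hanti hx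
      exact mem_iUnion.2 ⟨s, hs, by simpa using hs', subset_closure ⟨x, hx, rfl⟩⟩
    · intro hz
      obtain ⟨s, hs, hs', hcl⟩ := mem_iUnion.1 hz
      by_cases hzA : z ∈ e '' A
      · obtain ⟨x, -, rfl⟩ := hzA
        refine ⟨x, ?_, rfl⟩
        -- The closure taken in the cube adds no point of `e '' A`, because `frontier A` is closed
        -- in `X`.
        rw [← isClosed_frontier.closure_eq, he.closure_eq_preimage_closure_image]
        exact hcl
      · exact absurd (mem_iUnion.2 (exists_mem_dominatedSet_append he.continuous hs hzA)) hs'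
  rw [key]
  refine isSigmaCompact_iUnion (ι := List ℕ) _ fun s => ?_
  obtain ⟨F, hF, -, hFU, -⟩ := (isOpen_dominatedSet (A := A) (V := V) (e := e) s).exists_iUnion_isClosed
  refine ⟨fun n => F n ∩ ((⋃ i, dominatedSet A V e (s ++ [i]))ᶜ ∩ closure (e '' frontier A)),
    fun n => ((hF n).inter ((isOpen_iUnion fun i =>
      isOpen_dominatedSet _).isClosed_compl.inter isClosed_closure)).isCompact, ?_⟩
  rw [← iUnion_inter, hFU]

/-! ### Construction of the base -/

theorem hasOmegaOmegaBase_of_isSigmaCompact_frontier {X : Type*} [TopologicalSpace X]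
    [MetrizableSpace X] [SeparableSpace X]
    (h : ∀ A : Set X, IsClosed A → IsSigmaCompact (frontier A)) : HasOmegaOmegaBase (CL X) := by
  let _ := metrizableSpaceMetric X
  have : SecondCountableTopology X := UniformSpace.secondCountable_of_separable X
  intro H
  obtain ⟨K, hK, hKU⟩ := h H.1 H.2.2
  let W : (ℕ → ℕ) → Set X := fun α =>
    interior H.1 ∪ ⋃ n, Metric.thickening (1 / ((α (n + 1) : ℝ) + 1)) (K n)
  have hWo : ∀ α, IsOpen (W α) := fun α =>
    isOpen_interior.union (isOpen_iUnion fun n => Metric.isOpen_thickening)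
  have hHW : ∀ α, H.1 ⊆ W α := by
    intro α x hx
    by_cases hxi : x ∈ interior H.1
    · exact Or.inl hxi
    · have hxf : x ∈ ⋃ n, K n := hKU ▸ ⟨subset_closure hx, hxi⟩
      obtain ⟨n, hn⟩ := mem_iUnion.1 hxf
      exact Or.inr (mem_iUnion.2 ⟨n, Metric.self_subset_thickening (by positivity) _ hn⟩)
  let L : ℕ → Set (CL X) := fun N =>
    {F | ∀ b : countableBasis X, Encodable.encode b < N → (H.1 ∩ b).Nonempty → (F.1 ∩ b).Nonempty}
  refine ⟨fun α => {F | F.1 ⊆ W α} ∩ L (α 0), ⟨fun t => ⟨fun ht => ?_, ?_⟩⟩, ?_⟩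
  · obtain ⟨𝒰, hfin, ho, hH, hsub⟩ := CL.mem_nhds_iff.1 ht
    -- Compactness of `K n` provides a uniform radius.
    have hδ : ∀ n, ∃ m : ℕ, Metric.thickening (1 / ((m : ℝ) + 1)) (K n) ⊆ ⋃₀ 𝒰 := by
      intro n
      have hKH : K n ⊆ H.1 :=
        (subset_iUnion K n).trans (hKU.trans_subset H.2.2.frontier_subset)
      obtain ⟨δ, hδ, hδU⟩ :=
        (hK n).exists_thickening_subset_open (isOpen_sUnion ho) (hKH.trans hH.1)
      obtain ⟨m, hm⟩ := exists_nat_one_div_lt hδ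
      exact ⟨m, (Metric.thickening_mono hm.le _).trans hδU⟩
    choose m hm using hδ
    have hb : ∀ U ∈ 𝒰, ∃ b : countableBasis X, (b : Set X) ⊆ U ∧ (H.1 ∩ b).Nonempty := by
      intro U hU
      obtain ⟨x, hxH, hxU⟩ := hH.2 U hU
      obtain ⟨b, hb, hxb, hbU⟩ :=
        (isBasis_countableBasis X).exists_subset_of_mem_open hxU (ho U hU)
      exact ⟨⟨b, hb⟩, hbU, x, hxH, hxb⟩
    have : Nonempty (countableBasis X) := by
      obtain ⟨x, -⟩ := H.2.1
      obtain ⟨b, hb, -⟩ :=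
        (isBasis_countableBasis X).exists_subset_of_mem_open (mem_univ x) isOpen_univ
      exact ⟨⟨b, hb⟩⟩
    choose! b hbU hbH using hb
    obtain ⟨N, hN⟩ := (hfin.image fun U => Encodable.encode (b U)).bddAbove
    refine ⟨fun k => Nat.casesOn k (N + 1) m, trivial, ?_⟩
    rintro F ⟨hFW, hFL⟩
    refine hsub ⟨hFW.trans (union_subset (interior_subset.trans hH.1) (iUnion_subset hm)),
      fun U hU => ?_⟩
    exact (hFL (b U) (Nat.lt_succ_of_le (hN (mem_image_of_mem _ hU))) (hbH U hU)).mono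
      (inter_subset_inter_right _ (hbU U hU))
  · rintro ⟨α, -, hα⟩
    refine Filter.mem_of_superset (Filter.inter_mem
      (CL.setOf_subset_mem_nhds (hWo α) (hHW α)) ?_) hα
    have hfin : {b : countableBasis X | Encodable.encode b < α 0}.Finite :=
      (finite_lt_nat (α 0)).preimage Encodable.encode_injective.injOn
    have : (⋂ b ∈ {b : countableBasis X | Encodable.encode b < α 0},
        {F : CL X | (H.1 ∩ b).Nonempty → (F.1 ∩ b).Nonempty}) ∈ 𝓝 H := by
      refine (Filter.biInter_mem hfin).2 fun b _ => ?_
      by_cases hHb : (H.1 ∩ b).Nonempty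
      · exact Filter.mem_of_superset (CL.setOf_inter_nonempty_mem_nhds
          ((isBasis_countableBasis X).isOpen b.2) hHb) fun F hF _ => hF
      · exact Filter.univ_mem' fun F h => absurd h hHb
    exact Filter.mem_of_superset this fun F hF b hb => mem_iInter₂.1 hF b hb
  · rintro α β hαβ F ⟨hFW, hFL⟩
    refine ⟨hFW.trans (union_subset_union_right _ (iUnion_mono fun n =>
      Metric.thickening_mono ?_ _)), fun b hb => hFL b (hb.trans_le (hαβ 0))⟩
    have : (α (n + 1) : ℝ) ≤ β (n + 1) := by exact_mod_cast hαβ (n + 1)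
    gcongr

theorem theorem3p8 {X : Type*} [TopologicalSpace X] [MetrizableSpace X] :
    HasOmegaOmegaBase (CL X) ↔
      SeparableSpace X ∧ ∀ A : Set X, IsClosed A → IsSigmaCompact (frontier A) := by
  constructor
  · intro h
    have := h.separableSpace
    refine ⟨this, fun A hA => ?_⟩
    rcases A.eq_empty_or_nonempty with rfl | hne
    · simp
    · obtain ⟨V, hV, hanti⟩ := h.exists_hasBasis_nhdsSet hne hA
      exact isSigmaCompact_frontier_of_hasBasis_nhdsSet hA hV hanti
  · rintro ⟨hsep, h⟩
    exact hasOmegaOmegaBase_of_isSigmaCompact_frontier h
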